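/- Let $d$ be a non-negative integer, $Q=[a_1,b_1]\times\dots\times[a_d,b_d]\subset\mathbb{R}^d$ with $a_i<b_i$, let $\lambda$ be Lebesgue measure on $Q$ and $\sigma\in\{-1,0,1\}^d$. For $x,y\in Q$ write $x\le_\sigma y$ iff $\sigma_i x_i\le\sigma_i y_i$ for all $i$ with $\sigma_i=\pm1$ and $x_i=y_i$ for all $i$ with $\sigma_i=0$. Let $L^2_\sigma(Q,\mathbb{R})$ be the set of all $g\in L^2(Q,\mathbb{R})$ that are essentially $\sigma$-monotonic, that is, for which there is a $\lambda$-null set $N$ such that $g(x)\le g(y)$ for all $x,y\in Q\setminus N$ with $x\le_\sigma y$. A function on $Q$ is called dyadically grid-constant if, for some $n\in\mathbb{N}$, it is constant on each cell of the grid obtained by dividing every $[a_i,b_i]$ into $2^n$ intervals of equal length (closed on the left and open on the right, except for the last one, which is closed). For $c>0$ let $S(Q,[c,\infty))$ be the set of all dyadically grid-constant functions on $Q$ with values in $[c,\infty)$, and let $S^\infty(Q,(0,\infty)):=\bigcup_{c\in(0,\infty)}\overline{S(Q,[c,\infty))}^{\|\cdot\|_\infty}$, the closures being taken with respect to the essential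 supremum norm. For $w\in S^\infty(Q,(0,\infty))$ and $u,v\in L^2(Q,\mathbb{R})$ let $\langle u,v\rangle_{2,w}:=\int_Q u\,v\,w\,\mathrm{d}\lambda$ and, for $f\in L^2(Q,\mathbb{R})$, let $p_\sigma^w(f)$ be the $\sigma$-monotonic regression of $f$ with weight $w$, that is, the unique minimizer of $g\mapsto\langle f-g,f-g\rangle_{2,w}$ over $g\in L^2_\sigma(Q,\mathbb{R})$. Lemma. Suppose $f\in L^2(Q,\mathbb{R})$, $w\in S^\infty(Q,(0,\infty))$ and let $f^*:=p_\sigma^w(f)$. Then, for every function $\phi:\mathbb{R}\to\mathbb{R}$ of bounded variation, $\phi\circ f^*\in L^2(Q,\mathbb{R})$ and $$\langle f-f^*,\phi\circ f^*\rangle_{2,w}=0.$$ -/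

import Mathlib

open MeasureTheory Set Filter Topology
open scoped ENNReal

/-- The relation `x ≤_σ y` on `ℝ^d` for a signature `σ ∈ {-1, 0, 1}^d`. -/
def SigmaLE {d : ℕ} (σ : Fin d → SignType) (x y : Fin d → ℝ) : Prop :=
  ∀ i, (σ i ≠ 0 → (σ i : ℝ) * x i ≤ (σ i : ℝ) * y i) ∧ (σ i = 0 → x i = y i)

/-- Lebesgue measure on the cuboid `Q = [a_1, b_1] × ⋯ × [a_d, b_d]`, regarded as a measure on
`ℝ^d` for which the complement of `Q` is a null set. -/
noncomputable def cuboidMeasure {d : ℕ} (a b : Fin d → ℝ) : Measure (Fin d → ℝ) :=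
  (volume : Measure (Fin d → ℝ)).restrict (Set.Icc a b)

/-- `g` is essentially isotonic with respect to the relation `r`: its restriction to the complement
of some `μ`-null set is isotonic. -/
def EssentiallyIsotonic {X : Type*} [MeasurableSpace X] (μ : Measure X) (r : X → X → Prop)
    (g : X → ℝ) : Prop :=
  ∃ N : Set X, μ N = 0 ∧ ∀ x ∉ N, ∀ y ∉ N, r x y → g x ≤ g y

/-- The set `L²_σ(Q, ℝ)` of the elements of `L²(Q, ℝ)` that are essentially `σ`-monotonic. -/
def L2Sigma {d : ℕ} (a b : Fin d → ℝ) (σ : Fin d → SignType) :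
    Set (Lp ℝ 2 (cuboidMeasure a b)) :=
  {g | EssentiallyIsotonic (cuboidMeasure a b) (SigmaLE σ) g}

/-- The `k`-th point (`0 ≤ k ≤ 2 ^ n`) of the partition of `[α, β]` into `2 ^ n` intervals of
equal length. -/
noncomputable def dyadicPoint (α β : ℝ) (n k : ℕ) : ℝ := α + k * ((β - α) / 2 ^ n)

/-- The `k`-th dyadic partition interval of level `n` of `[α, β]` (`0 ≤ k < 2 ^ n`). It is closed on
the left and open on the right, except that the last one is closed. -/
noncomputable def dyadicInterval (α β : ℝ) (n k : ℕ) : Set ℝ :=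
  if k + 1 = 2 ^ n then Set.Icc (dyadicPoint α β n k) (dyadicPoint α β n (k + 1))
  else Set.Ico (dyadicPoint α β n k) (dyadicPoint α β n (k + 1))

/-- The cells of the dyadic grid of level `n` on the cuboid with corners `a` and `b`. -/
noncomputable def dyadicCell {d : ℕ} (a b : Fin d → ℝ) (n : ℕ) (k : Fin d → Fin (2 ^ n)) :
    Set (Fin d → ℝ) :=
  Set.pi Set.univ fun i => dyadicInterval (a i) (b i) n (k i)

/-- The set `S(Q, I)` of the dyadically grid-constant functions on `Q` with values in `I`. (The
values outside of `Q` are irrelevant.) -/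
def dyadicConstant {d : ℕ} (a b : Fin d → ℝ) (I : Set ℝ) : Set ((Fin d → ℝ) → ℝ) :=
  {s | (∃ n : ℕ, ∀ k : Fin d → Fin (2 ^ n),
      ∀ x ∈ dyadicCell a b n k, ∀ y ∈ dyadicCell a b n k, s x = s y) ∧
    ∀ x ∈ Set.Icc a b, s x ∈ I}

/-- The set `S^∞(Q, (0, ∞))`: the union over `c > 0` of the closures of `S(Q, [c, ∞))` with respect
to the `∞`-norm. -/
def SInftyPos {d : ℕ} (a b : Fin d → ℝ) : Set (Lp ℝ ∞ (cuboidMeasure a b)) :=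
  ⋃ c ∈ Set.Ioi (0 : ℝ), closure {u : Lp ℝ ∞ (cuboidMeasure a b) |
    ∃ s ∈ dyadicConstant a b (Set.Ici c), u =ᵐ[cuboidMeasure a b] s}

/-- The scalar product `⟨u, v⟩_{2,w} = ∫_Q u v w dλ`. -/
noncomputable def weightedInner {d : ℕ} (a b : Fin d → ℝ) (w u v : (Fin d → ℝ) → ℝ) : ℝ :=
  ∫ x, u x * v x * w x ∂(cuboidMeasure a b)

/-- `g` minimizes `h ↦ ‖f - h‖_{2,w}^2` over `L²_σ(Q, ℝ)`. -/
def IsMonotonicRegression {d : ℕ} (a b : Fin d → ℝ) (σ : Fin d → SignType)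
    (w : (Fin d → ℝ) → ℝ) (f g : Lp ℝ 2 (cuboidMeasure a b)) : Prop :=
  g ∈ L2Sigma a b σ ∧ ∀ h ∈ L2Sigma a b σ,
    weightedInner a b w (fun x => f x - g x) (fun x => f x - g x) ≤
      weightedInner a b w (fun x => f x - h x) (fun x => f x - h x)

theorem EssentiallyIsotonic.congr {X : Type*} [MeasurableSpace X] {μ ν : Measure X}
    {r : X → X → Prop} {g h : X → ℝ} (hg : EssentiallyIsotonic μ r g) (hνμ : ν ≪ μ)
    (hgh : g =ᵐ[ν] h) : EssentiallyIsotonic ν r h := by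
  obtain ⟨N, hN, H⟩ := hg
  refine ⟨N ∪ {x | ¬ g x = h x}, measure_union_null (hνμ hN) hgh, ?_⟩
  intro x hx y hy hxy
  simp only [mem_union, mem_ofPred_eq, not_or, not_not] at hx hy
  rw [← hx.2, ← hy.2]
  exact H x hx.1 y hy.1 hxy

theorem isClosed_essentiallyIsotonic {X : Type*} [MeasurableSpace X] (μ : Measure X)
    (r : X → X → Prop) : IsClosed {g : Lp ℝ 2 μ | EssentiallyIsotonic μ r g} := by
  refine isClosed_of_closure_subset fun g hg => ?_
  obtain ⟨u, hu, hlim⟩ := mem_closure_iff_seq_limit.1 hg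
  obtain ⟨ns, -, hns⟩ := (tendstoInMeasure_of_tendsto_Lp hlim).exists_seq_tendsto_ae
  choose N hN H using hu
  refine ⟨(⋃ n, N n) ∪ {x | ¬ Tendsto (fun i => u (ns i) x) atTop (𝓝 (g x))},
    measure_union_null (measure_iUnion_null hN) hns, ?_⟩
  intro x hx y hy hxy
  simp only [mem_union, mem_ofPred_eq, not_or, not_not, mem_iUnion, not_exists] at hx hy
  exact le_of_tendsto_of_tendsto' hx.2 hy.2 fun i => H _ x (hx.1 _) y (hy.1 _) hxy

theorem convex_essentiallyIsotonic {X : Type*} [MeasurableSpace X] (μ : Measure X)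
    (r : X → X → Prop) : Convex ℝ {g : Lp ℝ 2 μ | EssentiallyIsotonic μ r g} := by
  rintro g ⟨N, hN, H⟩ h ⟨M, hM, K⟩ s t hs ht -
  have e : (fun x => s * g x + t * h x) =ᵐ[μ] (s • g + t • h : Lp ℝ 2 μ) := by
    filter_upwards [Lp.coeFn_add (s • g) (t • h), Lp.coeFn_smul s g, Lp.coeFn_smul t h]
      with x h1 h2 h3
    rw [h1, Pi.add_apply, h2, h3]
    rfl
  refine EssentiallyIsotonic.congr ⟨N ∪ M, measure_union_null hN hM, ?_⟩
    (Measure.AbsolutelyContinuous.refl μ) e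
  intro x hx y hy hxy
  simp only [mem_union, not_or] at hx hy
  exact add_le_add (mul_le_mul_of_nonneg_left (H x hx.1 y hy.1 hxy) hs)
    (mul_le_mul_of_nonneg_left (K x hx.2 y hy.2 hxy) ht)

theorem SInftyPos.bounds {d : ℕ} {a b : Fin d → ℝ} {w : Lp ℝ ∞ (cuboidMeasure a b)}
    (hw : w ∈ SInftyPos a b) :
    ∃ c C : ℝ, 0 < c ∧ 0 < C ∧ ∀ᵐ x ∂(cuboidMeasure a b), c ≤ w x ∧ w x ≤ C := by
  simp only [SInftyPos, mem_iUnion, mem_Ioi] at hw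
  obtain ⟨c, hc, hw⟩ := hw
  obtain ⟨u, ⟨s, hs, hus⟩, hdist⟩ := Metric.mem_closure_iff.1 hw (c / 2) (half_pos hc)
  have key : ∀ v : Lp ℝ ∞ (cuboidMeasure a b), ∀ᵐ x ∂(cuboidMeasure a b), |v x| ≤ ‖v‖ := by
    intro v
    have h1 := ae_le_eLpNormEssSup (f := v) (μ := cuboidMeasure a b)
    filter_upwards [h1] with x hx
    rw [Lp.norm_def, ← Real.norm_eq_abs, ← toReal_enorm]
    refine ENNReal.toReal_mono (Lp.eLpNorm_ne_top v) ?_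
    rwa [eLpNorm_exponent_top]
  have hQ : ∀ᵐ x ∂(cuboidMeasure a b), x ∈ Set.Icc a b :=
    ae_restrict_mem measurableSet_Icc
  refine ⟨c / 2, ‖w‖ + 1, half_pos hc, by positivity, ?_⟩
  rw [dist_eq_norm] at hdist
  filter_upwards [key w, key (w - u), Lp.coeFn_sub w u, hus, hQ] with x h1 h2 h3 h4 h5
  rw [h3, Pi.sub_apply, h4] at h2
  have h6 : c ≤ s x := hs.2 x h5
  have h7 := (abs_le.1 h2).1
  have h8 := (abs_le.1 h1).2
  constructor <;> linarith

/-- The projection onto the `σ`-monotonic functions exists and is unique. -/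
theorem existsUnique_isMonotonicRegression {d : ℕ} (a b : Fin d → ℝ) (σ : Fin d → SignType)
    {w : Lp ℝ ∞ (cuboidMeasure a b)} (hw : w ∈ SInftyPos a b)
    (f : Lp ℝ 2 (cuboidMeasure a b)) : ∃! g, IsMonotonicRegression a b σ w f g := by
  obtain ⟨c, C, hc, hC, hb⟩ := SInftyPos.bounds hw
  have hwm : Measurable (fun x => (w x).toNNReal) :=
    (Lp.stronglyMeasurable w).measurable.real_toNNReal
  set ν : Measure (Fin d → ℝ) := (cuboidMeasure a b).withDensity (fun x => ((w x).toNNReal : ℝ≥0∞)) with hν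
  have hνμ : ν ≤ ENNReal.ofReal C • (cuboidMeasure a b) := by
    rw [← withDensity_const]
    refine withDensity_mono ?_
    filter_upwards [hb] with x hx
    exact ENNReal.ofReal_le_ofReal hx.2
  have hμν : (cuboidMeasure a b) ≤ ENNReal.ofReal c⁻¹ • ν := by
    have h1 : ENNReal.ofReal c • (cuboidMeasure a b) ≤ ν := by
      rw [← withDensity_const]
      refine withDensity_mono ?_
      filter_upwards [hb] with x hx
      exact ENNReal.ofReal_le_ofReal hx.1
    intro s
    have h2 := h1 s
    simp only [Measure.smul_apply, smul_eq_mul] at h2 ⊢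
    calc (cuboidMeasure a b) s = ENNReal.ofReal c⁻¹ * (ENNReal.ofReal c * (cuboidMeasure a b) s) := by
          rw [← mul_assoc, ← ENNReal.ofReal_mul (by positivity), inv_mul_cancel₀ hc.ne']
          simp
      _ ≤ _ := by gcongr
  have acνμ : ν ≪ (cuboidMeasure a b) := Measure.absolutelyContinuous_of_le_smul hνμ
  have acμν : (cuboidMeasure a b) ≪ ν := Measure.absolutelyContinuous_of_le_smul hμν
  have toν : ∀ g : Lp ℝ 2 (cuboidMeasure a b), MemLp g 2 ν := fun g =>
    (Lp.memLp g).of_measure_le_smul ENNReal.ofReal_ne_top hνμ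
  have toμ : ∀ g : Lp ℝ 2 ν, MemLp g 2 (cuboidMeasure a b) := fun g =>
    (Lp.memLp g).of_measure_le_smul ENNReal.ofReal_ne_top hμν
  let A : Lp ℝ 2 (cuboidMeasure a b) → Lp ℝ 2 ν := fun g => (toν g).toLp
  let B : Lp ℝ 2 ν → Lp ℝ 2 (cuboidMeasure a b) := fun g => (toμ g).toLp
  have hA : ∀ g : Lp ℝ 2 (cuboidMeasure a b), A g =ᵐ[ν] g := fun g => (toν g).coeFn_toLp
  have hB : ∀ g : Lp ℝ 2 ν, B g =ᵐ[(cuboidMeasure a b)] g := fun g => (toμ g).coeFn_toLp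
  have hAB : ∀ g, A (B g) = g := fun g =>
    Lp.ext ((hA _).trans (acνμ.ae_eq (hB g)))
  have hBA : ∀ g, B (A g) = g := fun g =>
    Lp.ext ((hB _).trans (acμν.ae_eq (hA g)))
  set K : Set (Lp ℝ 2 ν) := {g | EssentiallyIsotonic ν (SigmaLE σ) g} with hK
  have hAK : ∀ g, g ∈ L2Sigma a b σ → A g ∈ K := fun g hg =>
    EssentiallyIsotonic.congr hg acνμ (hA g).symm
  have hBK : ∀ g, g ∈ K → B g ∈ L2Sigma a b σ := fun g hg =>
    EssentiallyIsotonic.congr hg acμν (hB g).symm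
  have hnorm : ∀ g : Lp ℝ 2 (cuboidMeasure a b),
      weightedInner a b w (fun x => f x - g x) (fun x => f x - g x) = ‖A f - A g‖ ^ 2 := by
    intro g
    rw [← real_inner_self_eq_norm_sq, L2.inner_def]
    have e1 : ∫ x, inner ℝ ((A f - A g : Lp ℝ 2 ν) x) ((A f - A g : Lp ℝ 2 ν) x) ∂ν
        = ∫ x, (f x - g x) * (f x - g x) ∂ν := by
      refine integral_congr_ae ?_
      filter_upwards [Lp.coeFn_sub (A f) (A g), hA f, hA g] with x h1 h2 h3
      rw [h1, Pi.sub_apply, h2, h3]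
      rfl
    rw [e1, hν, integral_withDensity_eq_integral_smul hwm]
    refine integral_congr_ae ?_
    filter_upwards [hb] with x hx
    simp only [NNReal.smul_def, smul_eq_mul, Real.coe_toNNReal _ (hc.le.trans hx.1)]
    ring
  have hKc : Convex ℝ K := convex_essentiallyIsotonic ν _
  have hK0 : (0 : Lp ℝ 2 ν) ∈ K :=
    EssentiallyIsotonic.congr (μ := ν) (g := fun _ => 0) ⟨∅, by simp, by simp⟩
      (Measure.AbsolutelyContinuous.refl ν) (Lp.coeFn_zero ℝ 2 ν).symm
  have hreg : ∀ g, IsMonotonicRegression a b σ w f g ↔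
      A g ∈ K ∧ ∀ k ∈ K, inner ℝ (A f - A g) (k - A g) ≤ 0 := by
    intro g
    have mem : g ∈ L2Sigma a b σ ↔ A g ∈ K :=
      ⟨hAK g, fun h => by simpa only [hBA] using hBK _ h⟩
    rw [IsMonotonicRegression, mem]
    refine and_congr_right fun hg => ?_
    rw [← norm_eq_iInf_iff_real_inner_le_zero hKc hg]
    have : Nonempty K := ⟨⟨0, hK0⟩⟩
    have bdd : BddBelow (Set.range fun k : K => ‖A f - k‖) :=
      ⟨0, by rintro _ ⟨k, rfl⟩; exact norm_nonneg _⟩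
    constructor
    · intro h
      refine le_antisymm (le_ciInf fun k => ?_) (ciInf_le bdd ⟨A g, hg⟩)
      have h1 := h (B k) (hBK _ k.2)
      rw [hnorm, hnorm, hAB] at h1
      exact (sq_le_sq₀ (norm_nonneg _) (norm_nonneg _)).1 h1
    · intro h k hk
      rw [hnorm, hnorm, h]
      exact pow_le_pow_left₀ (Real.iInf_nonneg fun _ => norm_nonneg _)
        (ciInf_le bdd ⟨A k, hAK k hk⟩) 2
  obtain ⟨g, hg, hmin⟩ := exists_norm_eq_iInf_of_complete_convex ⟨0, hK0⟩
    (isClosed_essentiallyIsotonic ν (SigmaLE σ)).isComplete hKc (A f)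
  rw [norm_eq_iInf_iff_real_inner_le_zero hKc hg] at hmin
  refine ⟨B g, (hreg _).2 (by rw [hAB]; exact ⟨hg, hmin⟩), ?_⟩
  intro h hh
  obtain ⟨h1, h2⟩ := (hreg h).1 hh
  have h3 := h2 g hg
  have h4 := hmin (A h) h1
  have h5 : inner ℝ (A h - g) (A h - g) ≤ 0 := by
    have : inner ℝ (A h - g) (A h - g)
        = inner ℝ (A f - A h) (g - A h) + inner ℝ (A f - g) (A h - g) := by
      have e : g - A h = -(A h - g) := by abel
      rw [e, inner_neg_right, neg_add_eq_sub, ← inner_sub_left]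
      congr 1
      abel
    linarith
  have h6 : A h = g := by
    rw [real_inner_self_eq_norm_sq] at h5
    exact sub_eq_zero.1 (norm_eq_zero.1 (pow_eq_zero_iff two_ne_zero |>.1
      (le_antisymm h5 (sq_nonneg _))))
  rw [← h6, hBA]

/-- The `σ`-monotonic regression `p_σ^w(f)`: the unique minimizer of `h ↦ ‖f - h‖_{2,w}^2` over
`L²_σ(Q, ℝ)`. -/
noncomputable def monotonicRegression {d : ℕ} (a b : Fin d → ℝ) (σ : Fin d → SignType)
    {w : Lp ℝ ∞ (cuboidMeasure a b)} (hw : w ∈ SInftyPos a b)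
    (f : Lp ℝ 2 (cuboidMeasure a b)) : Lp ℝ 2 (cuboidMeasure a b) :=
  (existsUnique_isMonotonicRegression a b σ hw f).choose

/-! Write g for the regression. If `ψ` is bounded and Lipschitz, then for small `|ε|` the map `t ↦ t
+ ε ψ(t)` is monotone whatever the sign of `ε`, so g + ε ψ(g) is an admissible competitor.
Minimality makes the quadratic in `ε` minimal at 0, so its linear coefficient, a multiple of ⟨f - g,
ψ(g)⟩, vanishes (`IsMonotonicRegression.weightedInner_lipschitz_eq_zero`).

A general `φ` of bounded variation may jump, and then no such perturbation need be monotone.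
Instead, push the signed measure (f - g) w dλ forward along g. It annihilates all bounded Lipschitz
functions, hence is zero, and so annihilates every bounded Borel function
(`integral_mul_comp_eq_zero_of_forall_lipschitz`). Bounded variation enters only through
measurability and boundedness. -/

open scoped NNReal

/-- Finite measures that integrate bounded Lipschitz functions equally are equal. -/
theorem measure_ext_of_forall_integral_lipschitz {Ω : Type*} [MeasurableSpace Ω]
    [PseudoEMetricSpace Ω] [BorelSpace Ω] {μ ν : Measure Ω} [IsFiniteMeasure μ] [IsFiniteMeasure ν]
    (h : ∀ ψ : Ω → ℝ, (∃ K, LipschitzWith K ψ) → (∃ C, ∀ x, |ψ x| ≤ C) →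
      ∫ x, ψ x ∂μ = ∫ x, ψ x ∂ν) : μ = ν := by
  -- Thickened indicators of a closed set are Lipschitz with values in [0, 1], and their integrals
  -- tend to the measure of the set.
  have hF : ∀ F : Set Ω, IsClosed F → μ F = ν F := by
    intro F hF
    have hpos : ∀ n : ℕ, (0 : ℝ) < 1 / ((n : ℝ) + 1) := fun n => Nat.one_div_pos_of_nat
    have h1 := tendsto_lintegral_thickenedIndicator_of_isClosed μ hF hpos
      tendsto_one_div_add_atTop_nhds_zero_nat
    have h2 := tendsto_lintegral_thickenedIndicator_of_isClosed ν hF hpos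
      tendsto_one_div_add_atTop_nhds_zero_nat
    refine tendsto_nhds_unique h1 (h2.congr fun n => ?_)
    have e : ∀ (ρ : Measure Ω) [IsFiniteMeasure ρ],
        ∫⁻ x, (thickenedIndicator (hpos n) F x : ℝ≥0∞) ∂ρ
          = ENNReal.ofReal (∫ x, (thickenedIndicator (hpos n) F x : ℝ) ∂ρ) := by
      intro ρ _
      rw [ofReal_integral_eq_lintegral_ofReal (integrable_thickenedIndicator F (hpos n))
        (ae_of_all _ fun x => NNReal.coe_nonneg _)]
      simp
    rw [e μ, e ν, h (fun x => (thickenedIndicator (hpos n) F x : ℝ))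
      ⟨_, NNReal.isometry_coe.lipschitz.comp (lipschitzWith_thickenedIndicator (hpos n) F)⟩
      ⟨1, fun x => ?_⟩]
    rw [NNReal.abs_eq]
    exact_mod_cast thickenedIndicator_le_one (hpos n) F x
  refine ext_of_generate_finite _ (BorelSpace.measurable_eq.trans (borel_eq_generateFrom_isClosed))
    isPiSystem_isClosed (fun F h => hF F h) (hF _ isClosed_univ)

/-- If `h` is orthogonal to all bounded Lipschitz functions of `g`, then it is orthogonal to all
bounded Borel functions of `g`. -/
theorem integral_mul_comp_eq_zero_of_forall_lipschitz {X : Type*} [MeasurableSpace X]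
    {μ : Measure X} {h g : X → ℝ} (hh : Integrable h μ) (hg : Measurable g)
    (H : ∀ ψ : ℝ → ℝ, (∃ K, LipschitzWith K ψ) → (∃ C, ∀ t, |ψ t| ≤ C) →
      ∫ x, h x * ψ (g x) ∂μ = 0)
    {φ : ℝ → ℝ} (hφ : Measurable φ) (hφb : ∃ C, ∀ t, |φ t| ≤ C) :
    ∫ x, h x * φ (g x) ∂μ = 0 := by
  -- Since `ENNReal.ofReal` truncates at 0, `D h` and `D (-h)` have densities h⁺ and h⁻: they
  -- represent the signed measure h dμ as a difference of positive measures.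
  let D : (X → ℝ) → Measure X := fun u => μ.withDensity fun x => ENNReal.ofReal (u x)
  have hfin : ∀ {u : X → ℝ}, Integrable u μ → IsFiniteMeasure ((D u).map g) := by
    intro u hu
    have : IsFiniteMeasure (D u) := isFiniteMeasure_withDensity_ofReal hu.2
    infer_instance
  have key : ∀ {u : X → ℝ}, Integrable u μ → ∀ {ψ : ℝ → ℝ}, Measurable ψ →
      ∫ t, ψ t ∂((D u).map g) = ∫ x, max (u x) 0 * ψ (g x) ∂μ := by
    intro u hu ψ hψ
    rw [integral_map hg.aemeasurable hψ.aestronglyMeasurable,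
      integral_withDensity_eq_integral_toReal_smul₀ hu.aemeasurable.ennreal_ofReal
        (ae_of_all _ fun x => ENNReal.ofReal_lt_top)]
    simp only [ENNReal.toReal_ofReal', smul_eq_mul]
  have hdiff : ∀ {ψ : ℝ → ℝ}, Measurable ψ → (∃ C, ∀ t, |ψ t| ≤ C) →
      ∫ t, ψ t ∂((D h).map g) - ∫ t, ψ t ∂((D (-h)).map g) = ∫ x, h x * ψ (g x) ∂μ := by
    rintro ψ hψ ⟨C, hC⟩
    have hi : ∀ {u : X → ℝ}, Integrable u μ → Integrable (fun x => max (u x) 0 * ψ (g x)) μ :=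
      fun hu => hu.pos_part.mul_bdd (c := C) (hψ.comp hg).aestronglyMeasurable
        (ae_of_all _ fun x => hC _)
    rw [key hh hψ, key hh.neg hψ, ← integral_sub (hi hh) (hi hh.neg)]
    congr 1 with x
    rw [← sub_mul, Pi.neg_apply, max_zero_sub_max_neg_zero_eq_self]
  have := hfin hh
  have := hfin hh.neg
  have heq : (D h).map g = (D (-h)).map g := by
    refine measure_ext_of_forall_integral_lipschitz fun ψ hψ hb => ?_
    rw [← sub_eq_zero, hdiff hψ.choose_spec.continuous.measurable hb, H ψ hψ hb]
  rw [← hdiff hφ hφb, heq, sub_self]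

/-- By Jordan decomposition: a difference of two monotone functions is Borel. -/
theorem BoundedVariationOn.measurable {φ : ℝ → ℝ} (hφ : BoundedVariationOn φ univ) :
    Measurable φ := by
  obtain ⟨p, q, hp, hq, rfl⟩ :=
    hφ.locallyBoundedVariationOn.exists_monotoneOn_sub_monotoneOn
  exact (monotoneOn_univ.1 hp).measurable.sub (monotoneOn_univ.1 hq).measurable

theorem BoundedVariationOn.exists_abs_le {φ : ℝ → ℝ} (hφ : BoundedVariationOn φ univ) :
    ∃ C, ∀ t, |φ t| ≤ C := by
  refine ⟨|φ 0| + (eVariationOn φ univ).toReal, fun t => ?_⟩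
  have h1 := hφ.dist_le (mem_univ t) (mem_univ 0)
  have h2 := abs_sub_abs_le_abs_sub (φ t) (φ 0)
  rw [Real.dist_eq] at h1
  linarith

/-- Between s ≤ t the perturbation changes by at most `|ε| K (t - s) ≤ t - s`, so it cannot undo the
increase of the identity. Both signs of `ε` are needed to get an equality from minimality. -/
theorem LipschitzWith.monotone_add_mul {ψ : ℝ → ℝ} {K : ℝ≥0} (hψ : LipschitzWith K ψ) {ε : ℝ}
    (hε : |ε| * K ≤ 1) : Monotone fun t => t + ε * ψ t := by
  intro s t hst
  have h1 : |ε * (ψ s - ψ t)| ≤ t - s := by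
    have h2 := hψ.dist_le_mul s t
    rw [Real.dist_eq, Real.dist_eq, abs_sub_comm s t, abs_of_nonneg (sub_nonneg.2 hst)] at h2
    rw [abs_mul]
    nlinarith [abs_nonneg ε, mul_le_mul_of_nonneg_left h2 (abs_nonneg ε)]
  have h3 := le_of_abs_le h1
  dsimp only
  linarith

theorem EssentiallyIsotonic.monotone_comp {X : Type*} [MeasurableSpace X] {μ : Measure X}
    {r : X → X → Prop} {g : X → ℝ} (hg : EssentiallyIsotonic μ r g) {χ : ℝ → ℝ}
    (hχ : Monotone χ) : EssentiallyIsotonic μ r fun x => χ (g x) := by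
  obtain ⟨N, hN, H⟩ := hg
  exact ⟨N, hN, fun x hx y hy hxy => hχ (H x hx y hy hxy)⟩

instance isFiniteMeasure_cuboidMeasure {d : ℕ} (a b : Fin d → ℝ) :
    IsFiniteMeasure (cuboidMeasure a b) :=
  isFiniteMeasure_restrict.2 isCompact_Icc.measure_lt_top.ne

/-- If `2 ε I ≤ ε² J` for all small `ε`, then `I = 0`. -/
theorem eq_zero_of_forall_two_mul_le_sq {I J δ : ℝ} (hδ : 0 < δ)
    (h : ∀ ε, |ε| ≤ δ → 2 * ε * I ≤ ε ^ 2 * J) : I = 0 := by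
  -- The hypothesis says that this quadratic, which vanishes at 0, has a local minimum there; its
  -- derivative `-2I` must be zero.
  have hd : HasDerivAt (fun ε : ℝ => ε ^ 2 * J - 2 * ε * I) (-(2 * I)) 0 := by
    have h1 := (((hasDerivAt_id (0 : ℝ)).pow 2).mul_const J).sub
      (((hasDerivAt_id (0 : ℝ)).const_mul 2).mul_const I)
    exact h1.congr_deriv (by simp)
  have hmin : IsLocalMin (fun ε : ℝ => ε ^ 2 * J - 2 * ε * I) 0 := by
    filter_upwards [Metric.closedBall_mem_nhds (0 : ℝ) hδ] with ε hε
    rw [Metric.mem_closedBall, Real.dist_eq, sub_zero] at hε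
    have := h ε hε
    norm_num
    linarith
  have := hmin.hasDerivAt_eq_zero hd
  linarith

section Regression

variable {d : ℕ} {a b : Fin d → ℝ} {σ : Fin d → SignType} {w : Lp ℝ ∞ (cuboidMeasure a b)}
  {f g : Lp ℝ 2 (cuboidMeasure a b)}

theorem integrable_mul_mul_weight {u v : (Fin d → ℝ) → ℝ} (hu : MemLp u 2 (cuboidMeasure a b))
    (hv : MemLp v 2 (cuboidMeasure a b)) :
    Integrable (fun x => u x * v x * w x) (cuboidMeasure a b) :=
  (MemLp.integrable_mul hu hv).mul_of_top_left (Lp.memLp w)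

theorem memLp_comp_of_bounded {ψ : ℝ → ℝ} (hψ : Measurable ψ) (hb : ∃ C, ∀ t, |ψ t| ≤ C) :
    MemLp (fun x => ψ (g x)) 2 (cuboidMeasure a b) := by
  obtain ⟨C, hC⟩ := hb
  exact MemLp.of_bound
    (hψ.comp (Lp.stronglyMeasurable g).measurable).aestronglyMeasurable C
    (ae_of_all _ fun x => hC _)

/-- The residual of a regression is orthogonal to bounded Lipschitz functions of the regression:
these can be added to and subtracted from it, with a small factor, without losing monotonicity. -/
theorem IsMonotonicRegression.weightedInner_lipschitz_eq_zero
    (hg : IsMonotonicRegression a b σ w f g) {ψ : ℝ → ℝ} {K : ℝ≥0} (hψ : LipschitzWith K ψ)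
    (hb : ∃ C, ∀ t, |ψ t| ≤ C) :
    weightedInner a b w (fun x => f x - g x) (fun x => ψ (g x)) = 0 := by
  have hψg : MemLp (fun x => ψ (g x)) 2 (cuboidMeasure a b) :=
    memLp_comp_of_bounded hψ.continuous.measurable hb
  have hfg : MemLp (fun x => f x - g x) 2 (cuboidMeasure a b) := (Lp.memLp f).sub (Lp.memLp g)
  -- The summand 1 keeps the bound meaningful for `K = 0`.
  have hδ : (0 : ℝ) < 1 / (K + 1) := by positivity
  refine eq_zero_of_forall_two_mul_le_sq hδ
    (J := weightedInner a b w (fun x => ψ (g x)) (fun x => ψ (g x))) fun ε hε => ?_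
  have hεK : |ε| * K ≤ 1 := by
    rw [le_div_iff₀ (by positivity)] at hε
    nlinarith [abs_nonneg ε]
  have hk : MemLp (fun x => g x + ε * ψ (g x)) 2 (cuboidMeasure a b) :=
    (Lp.memLp g).add (hψg.const_mul ε)
  have hmem : hk.toLp ∈ L2Sigma a b σ :=
    (hg.1.monotone_comp (hψ.monotone_add_mul hεK)).congr
      (Measure.AbsolutelyContinuous.refl _) hk.coeFn_toLp.symm
  have hle := hg.2 _ hmem
  have i1 := integrable_mul_mul_weight (w := w) hfg hfg
  have i2 := integrable_mul_mul_weight (w := w) hfg hψg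
  have i3 := integrable_mul_mul_weight (w := w) hψg hψg
  have expand : weightedInner a b w (fun x => f x - (hk.toLp _) x) (fun x => f x - (hk.toLp _) x)
      = weightedInner a b w (fun x => f x - g x) (fun x => f x - g x)
        - 2 * ε * weightedInner a b w (fun x => f x - g x) (fun x => ψ (g x))
        + ε ^ 2 * weightedInner a b w (fun x => ψ (g x)) (fun x => ψ (g x)) := by
    simp only [weightedInner]
    rw [← integral_const_mul, ← integral_const_mul, ← integral_sub i1 (i2.const_mul _),
      ← integral_add (by exact i1.sub (i2.const_mul _)) (i3.const_mul _)]
    refine integral_congr_ae ?_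
    filter_upwards [hk.coeFn_toLp] with x hx
    rw [hx]
    ring
  linarith

theorem IsMonotonicRegression.weightedInner_comp_eq_zero
    (hg : IsMonotonicRegression a b σ w f g) {φ : ℝ → ℝ} (hφ : Measurable φ)
    (hb : ∃ C, ∀ t, |φ t| ≤ C) :
    weightedInner a b w (fun x => f x - g x) (fun x => φ (g x)) = 0 := by
  have hfg : MemLp (fun x => f x - g x) 2 (cuboidMeasure a b) := (Lp.memLp f).sub (Lp.memLp g)
  -- On a finite measure L² lies in L¹, and the weight is essentially bounded; this is the density
  -- to be pushed forward along `g`.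
  have hh : Integrable (fun x => (f x - g x) * w x) (cuboidMeasure a b) :=
    (hfg.integrable one_le_two).mul_of_top_left (Lp.memLp w)
  have e : ∀ ψ : ℝ → ℝ, weightedInner a b w (fun x => f x - g x) (fun x => ψ (g x))
      = ∫ x, (f x - g x) * w x * ψ (g x) ∂(cuboidMeasure a b) := fun ψ =>
    integral_congr_ae (ae_of_all _ fun x => mul_right_comm _ _ _)
  rw [e]
  refine integral_mul_comp_eq_zero_of_forall_lipschitz hh (Lp.stronglyMeasurable g).measurable
    (fun ψ ⟨K, hψ⟩ hψb => ?_) hφ hb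
  rw [← e, hg.weightedInner_lipschitz_eq_zero hψ hψb]

end Regression

theorem lemma5p1 {d : ℕ} (a b : Fin d → ℝ) (hab : ∀ i, a i < b i) (σ : Fin d → SignType)
    (f : Lp ℝ 2 (cuboidMeasure a b)) (w : Lp ℝ ∞ (cuboidMeasure a b)) (hw : w ∈ SInftyPos a b)
    (φ : ℝ → ℝ) (hφ : BoundedVariationOn φ Set.univ) :
    MemLp (fun x => φ (monotonicRegression a b σ hw f x)) 2 (cuboidMeasure a b) ∧
      weightedInner a b w (fun x => f x - monotonicRegression a b σ hw f x)
        (fun x => φ (monotonicRegression a b σ hw f x)) = 0 := by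
  have hreg : IsMonotonicRegression a b σ w f (monotonicRegression a b σ hw f) :=
    (existsUnique_isMonotonicRegression a b σ hw f).choose_spec.1
  exact ⟨memLp_comp_of_bounded hφ.measurable hφ.exists_abs_le,
    hreg.weightedInner_comp_eq_zero hφ.measurable hφ.exists_abs_le⟩
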